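/- Let $m\in\mathbb N$ and let $V:\mathbb R\to\mathbb C^{m\times m}$ be a measurable function whose values are Hermitian matrices with $V(x)\ge 0$ (positive semidefinite) for almost every $x$. Let $H=-\frac{d^2}{dx^2}-V$ be the Schrödinger operator in $L^2(\mathbb R,\mathbb C^m)$ associated with the quadratic form $$q[\psi,\phi]=\int_{\mathbb R}\langle \psi'(x),\phi'(x)\rangle\,dx-\int_{\mathbb R}\langle\psi(x),V(x)\phi(x)\rangle\,dx,\qquad \psi,\phi\in H^1(\mathbb R,\mathbb C^m),$$ that is, $\phi$ is in the domain of $H$ with $H\phi=f\in L^2(\mathbb R,\mathbb C^m)$ if and only if $\phi\in H^1(\mathbb R,\mathbb C^m)$ and, for every $\psi\in H^1(\mathbb R,\mathbb C^m)$, the function $\langle\psi,V\phi\rangle$ is integrable and $q[\psi,\phi]=\int_{\mathbb R}\langle\psi,f\rangle\,dx$. Let $\lambda_n$ be all the negative eigenvalues of $H$, repeated according to multiplicity. Then $$\sum_n|\lambda_n|\le\frac{2}{3\sqrt3}\int_{\mathbb R}\operatorname{Tr}\big[V(x)^{3/2}\big]\,dx ,$$ where both sides are in $[0,\infty]$; in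 particular the sum is finite whenever the integral is. -/

import Mathlib

open MeasureTheory
open scoped ENNReal ContDiff Matrix ComplexOrder

/-- The Hilbert space `L²(ℝ, ℂᵐ)`, with inner product
`⟪ψ, φ⟫ = ∫ ∑ j, conj (ψ x j) * φ x j`. -/
abbrev L2Vec (m : ℕ) : Type := Lp (EuclideanSpace ℂ (Fin m)) 2 (volume : Measure ℝ)

/-- A function in `L²` multiplied by a smooth compactly supported function is integrable. -/
theorem L2Vec.integrable_smul {m : ℕ} (u : L2Vec m) {η : ℝ → ℝ} (h : Continuous η)
    (hc : HasCompactSupport η) : Integrable (fun x => η x • u x) := by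
  have h1 : MemLp η 2 volume := h.memLp_of_hasCompactSupport hc
  have h2 : MemLp (fun x => η x • u x) 1 volume := (Lp.memLp u).smul h1
  exact memLp_one_iff_integrable.mp h2

/-- The weak derivative in `L²(ℝ, ℂᵐ)`, as a graph. The pair `(u, g)` belongs to it when `g` is the
distributional derivative of `u`: `∫ η' u = - ∫ η g` for all `η ∈ C_c^∞(ℝ)`.
Thus `u ∈ H¹(ℝ, ℂᵐ)` if and only if `(u, g) ∈ weakDerivGraph m` for some `g`, and then `g = u'`. -/
def weakDerivGraph (m : ℕ) : Submodule ℂ (L2Vec m × L2Vec m) where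
  carrier := {p | ∀ η : ℝ → ℝ, ContDiff ℝ ∞ η → HasCompactSupport η →
    ∫ x, deriv η x • p.1 x = - ∫ x, η x • p.2 x}
  zero_mem' := by
    intro η _ _
    simp
  add_mem' := by
    rintro ⟨u, g⟩ ⟨v, k⟩ h1 h2 η hη hc
    have a1 := h1 η hη hc
    have a2 := h2 η hη hc
    have hd : Continuous (deriv η) := hη.continuous_deriv (by simp)
    have e1 : ∫ x, deriv η x • (u + v) x
        = (∫ x, deriv η x • u x) + ∫ x, deriv η x • v x := by
      rw [← integral_add (u.integrable_smul hd hc.deriv) (v.integrable_smul hd hc.deriv)]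
      refine integral_congr_ae ?_
      filter_upwards [Lp.coeFn_add u v] with x hx
      rw [hx, Pi.add_apply, smul_add]
    have e2 : ∫ x, η x • (g + k) x = (∫ x, η x • g x) + ∫ x, η x • k x := by
      rw [← integral_add (g.integrable_smul hη.continuous hc)
        (k.integrable_smul hη.continuous hc)]
      refine integral_congr_ae ?_
      filter_upwards [Lp.coeFn_add g k] with x hx
      rw [hx, Pi.add_apply, smul_add]
    simp only [Prod.mk_add_mk] at *
    rw [e1, e2, a1, a2, neg_add]
  smul_mem' := by
    rintro c ⟨u, g⟩ h1 η hη hc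
    have a1 := h1 η hη hc
    have e1 : ∫ x, deriv η x • (c • u) x = c • ∫ x, deriv η x • u x := by
      rw [← integral_smul]
      refine integral_congr_ae ?_
      filter_upwards [Lp.coeFn_smul c u] with x hx
      simp [hx, smul_comm c]
    have e2 : ∫ x, η x • (c • g) x = c • ∫ x, η x • g x := by
      rw [← integral_smul]
      refine integral_congr_ae ?_
      filter_upwards [Lp.coeFn_smul c g] with x hx
      simp [hx, smul_comm c]
    simp only [Prod.smul_mk] at *
    rw [e1, e2, a1, smul_neg]

/-- The density `⟨ψ(x), V(x) φ(x)⟩` of the potential term of the quadratic form. -/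
noncomputable def potentialDensity {m : ℕ} (V : ℝ → Matrix (Fin m) (Fin m) ℂ) (ψ φ : L2Vec m)
    (x : ℝ) : ℂ :=
  star (ψ x).ofLp ⬝ᵥ (V x *ᵥ (φ x).ofLp)

/-- The graph of the Schrödinger operator `-d²/dx² - V` in `L²(ℝ, ℂᵐ)`, defined through its
quadratic form on `H¹(ℝ, ℂᵐ)`: one has `H φ = f` when `φ ∈ H¹` and
`∫ ⟨ψ', φ'⟩ - ∫ ⟨ψ, V φ⟩ = ∫ ⟨ψ, f⟩` for all `ψ ∈ H¹`.
The integrability of `⟨ψ, V φ⟩`, which makes the form meaningful, holds for all `ψ, φ ∈ H¹` as soon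
as `∫ Tr V^{3/2}` is finite. -/
def schrodingerGraph {m : ℕ} (V : ℝ → Matrix (Fin m) (Fin m) ℂ) :
    Submodule ℂ (L2Vec m × L2Vec m) where
  carrier := {p | ∃ dφ : L2Vec m, (p.1, dφ) ∈ weakDerivGraph m ∧
    ∀ ψ dψ : L2Vec m, (ψ, dψ) ∈ weakDerivGraph m →
      Integrable (potentialDensity V ψ p.1) ∧
      inner ℂ dψ dφ - ∫ x, potentialDensity V ψ p.1 x = inner ℂ ψ p.2}
  zero_mem' := by
    refine ⟨0, (weakDerivGraph m).zero_mem, fun ψ dψ _ => ?_⟩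
    have h : potentialDensity V ψ (0 : L2Vec m × L2Vec m).1 = 0 := by
      ext x
      simp [potentialDensity]
    rw [h]
    exact ⟨integrable_zero _ _ _, by simp⟩
  add_mem' := by
    rintro ⟨φ₁, f₁⟩ ⟨φ₂, f₂⟩ ⟨d₁, hd₁, h₁⟩ ⟨d₂, hd₂, h₂⟩
    refine ⟨d₁ + d₂, (weakDerivGraph m).add_mem hd₁ hd₂, fun ψ dψ hψ => ?_⟩
    obtain ⟨i₁, e₁⟩ := h₁ ψ dψ hψ
    obtain ⟨i₂, e₂⟩ := h₂ ψ dψ hψ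
    have h : potentialDensity V ψ (φ₁ + φ₂) =ᵐ[volume]
        fun x => potentialDensity V ψ φ₁ x + potentialDensity V ψ φ₂ x := by
      filter_upwards [Lp.coeFn_add φ₁ φ₂] with x hx
      simp only [potentialDensity]
      rw [hx, Pi.add_apply, WithLp.ofLp_add, Matrix.mulVec_add, dotProduct_add]
    simp only [Prod.mk_add_mk] at *
    refine ⟨(integrable_congr h).mpr (i₁.add i₂), ?_⟩
    rw [integral_congr_ae h, integral_add i₁ i₂, inner_add_right, inner_add_right, ← e₁, ← e₂]
    ring
  smul_mem' := by
    rintro c ⟨φ, f⟩ ⟨d, hd, h₁⟩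
    refine ⟨c • d, (weakDerivGraph m).smul_mem c hd, fun ψ dψ hψ => ?_⟩
    obtain ⟨i₁, e₁⟩ := h₁ ψ dψ hψ
    have h : potentialDensity V ψ (c • φ) =ᵐ[volume] fun x => c * potentialDensity V ψ φ x := by
      filter_upwards [Lp.coeFn_smul c φ] with x hx
      simp [potentialDensity, hx, Matrix.mulVec_smul, dotProduct_smul]
    simp only [Prod.smul_mk] at *
    refine ⟨(integrable_congr h).mpr (i₁.const_mul c), ?_⟩
    rw [integral_congr_ae h, integral_const_mul, inner_smul_right, inner_smul_right, ← e₁]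
    ring

/-- For `η ∈ C_c^∞(ℝ)` and `c ∈ ℂᵐ` the function `η c` is in `H¹`, with weak derivative `η' c`. -/
theorem smul_const_mem_weakDerivGraph {m : ℕ} {η : ℝ → ℝ} (hη : ContDiff ℝ ∞ η)
    (hc : HasCompactSupport η) (c : EuclideanSpace ℂ (Fin m)) :
    ∃ ψ dψ : L2Vec m, (ψ, dψ) ∈ weakDerivGraph m ∧ ψ =ᵐ[volume] fun x => η x • c := by
  have hd : Continuous (deriv η) := hη.continuous_deriv (by simp)
  have m1 : MemLp (fun x => η x • c) 2 (volume : Measure ℝ) :=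
    (hη.continuous.smul continuous_const).memLp_of_hasCompactSupport hc.smul_right
  have m2 : MemLp (fun x => deriv η x • c) 2 (volume : Measure ℝ) :=
    (hd.smul continuous_const).memLp_of_hasCompactSupport hc.deriv.smul_right
  refine ⟨m1.toLp _, m2.toLp _, ?_, m1.coeFn_toLp⟩
  intro θ hθ hθc
  have hθd : Continuous (deriv θ) := hθ.continuous_deriv (by simp)
  have e1 : ∫ x, deriv θ x • (m1.toLp _) x = (∫ x, deriv θ x * η x) • c := by
    rw [← integral_smul_const]
    refine integral_congr_ae ?_
    filter_upwards [m1.coeFn_toLp] with x hx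
    rw [hx, smul_smul]
  have e2 : ∫ x, θ x • (m2.toLp _) x = (∫ x, θ x * deriv η x) • c := by
    rw [← integral_smul_const]
    refine integral_congr_ae ?_
    filter_upwards [m2.coeFn_toLp] with x hx
    rw [hx, smul_smul]
  have e3 : ∫ x, θ x * deriv η x = - ∫ x, deriv θ x * η x :=
    integral_mul_deriv_eq_deriv_mul_of_integrable
      (fun x _ => (hθ.differentiable (by simp)).differentiableAt.hasDerivAt)
      (fun x _ => (hη.differentiable (by simp)).differentiableAt.hasDerivAt)
      ((hθ.continuous.mul hd).integrable_of_hasCompactSupport hθc.mul_right)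
      ((hθd.mul hη.continuous).integrable_of_hasCompactSupport hθc.deriv.mul_right)
      ((hθ.continuous.mul hη.continuous).integrable_of_hasCompactSupport hθc.mul_right)
  simp only
  rw [e1, e2, e3, neg_smul, neg_neg]

/-- The value `H φ` is determined by `φ`, because `H¹` is dense in `L²`. -/
theorem schrodingerGraph_snd_eq_zero {m : ℕ} (V : ℝ → Matrix (Fin m) (Fin m) ℂ)
    (p : L2Vec m × L2Vec m) (hp : p ∈ schrodingerGraph V) (hp0 : p.1 = 0) : p.2 = 0 := by
  obtain ⟨φ, f⟩ := p
  obtain ⟨d, hd, h⟩ := hp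
  simp only at hp0 hd h ⊢
  subst hp0
  have hd0 : d = 0 := by
    have hloc : LocallyIntegrable d volume :=
      (Lp.memLp d).locallyIntegrable (by norm_num)
    have := ae_eq_zero_of_integral_contDiff_smul_eq_zero hloc (fun η hη hc => by
      have h1 := hd η hη hc
      have h0 : ∫ x, deriv η x • (0 : L2Vec m) x = 0 :=
        by simp
      simp only at h1
      rw [h0] at h1
      exact neg_eq_zero.mp h1.symm)
    exact (Lp.eq_zero_iff_ae_eq_zero).mpr this
  subst hd0
  have hloc : LocallyIntegrable f volume := (Lp.memLp f).locallyIntegrable (by norm_num)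
  refine (Lp.eq_zero_iff_ae_eq_zero).mpr
    (ae_eq_zero_of_integral_contDiff_smul_eq_zero hloc (fun η hη hc => ?_))
  refine ext_inner_left ℂ (fun c => ?_)
  obtain ⟨ψ, dψ, hψ, hψe⟩ := smul_const_mem_weakDerivGraph hη hc c
  obtain ⟨-, e⟩ := h ψ dψ hψ
  have hz : potentialDensity V ψ (0 : L2Vec m) = 0 := by
    ext x
    simp [potentialDensity]
  rw [hz] at e
  simp only [inner_zero_right, Pi.zero_apply, integral_zero, sub_zero] at e ⊢
  rw [← integral_inner (f.integrable_smul hη.continuous hc), e, L2.inner_def]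
  refine integral_congr_ae ?_
  filter_upwards [hψe] with x hx
  rw [hx, ← Complex.coe_smul, ← Complex.coe_smul, inner_smul_left, inner_smul_right,
    Complex.conj_ofReal]

/-- The Schrödinger operator `H = -d²/dx² - V` as an unbounded operator in `L²(ℝ, ℂᵐ)`. -/
noncomputable def schrodinger {m : ℕ} (V : ℝ → Matrix (Fin m) (Fin m) ℂ) :
    L2Vec m →ₗ.[ℂ] L2Vec m :=
  (schrodingerGraph V).toLinearPMap

theorem schrodinger_graph {m : ℕ} (V : ℝ → Matrix (Fin m) (Fin m) ℂ) :
    (schrodinger V).graph = schrodingerGraph V :=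
  Submodule.toLinearPMap_graph_eq _ (schrodingerGraph_snd_eq_zero V)

/-- The space of all `φ` in the domain of the unbounded operator `T` with `T φ = μ φ`. -/
def LinearPMap.eigenspace {E : Type*} [AddCommGroup E] [Module ℂ E] (T : E →ₗ.[ℂ] E) (μ : ℂ) :
    Submodule ℂ E :=
  T.graph.comap (LinearMap.id.prod (μ • LinearMap.id))

theorem LinearPMap.mem_eigenspace_iff {E : Type*} [AddCommGroup E] [Module ℂ E]
    (T : E →ₗ.[ℂ] E) (μ : ℂ) (φ : E) :
    φ ∈ T.eigenspace μ ↔ ∃ h : φ ∈ T.domain, T ⟨φ, h⟩ = μ • φ := by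
  simp [LinearPMap.eigenspace, LinearPMap.mem_graph_iff]

/-- The multiplicity (geometric, possibly `0` or `∞`) of `μ` as an eigenvalue of `T`. -/
noncomputable def LinearPMap.multiplicity {E : Type*} [AddCommGroup E] [Module ℂ E]
    (T : E →ₗ.[ℂ] E) (μ : ℂ) : ℕ∞ :=
  Cardinal.toENat (Module.rank ℂ (T.eigenspace μ))

/-- The sum `∑ |λₙ|` over all negative eigenvalues of `T`, repeated according to multiplicity. -/
noncomputable def LinearPMap.sumAbsNegEigenvalues {E : Type*} [AddCommGroup E] [Module ℂ E]
    (T : E →ₗ.[ℂ] E) : ℝ≥0∞ :=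
  ∑' lam : {lam : ℝ // lam < 0},
    (T.multiplicity ((lam : ℝ) : ℂ) : ℝ≥0∞) * ENNReal.ofReal |(lam : ℝ)|

/-- `Tr [A^{3/2}]` for a positive semidefinite Hermitian matrix `A`, the power being taken in the
functional calculus of `A`. -/
noncomputable def traceThreeHalves {m : ℕ} (A : Matrix (Fin m) (Fin m) ℂ) : ℝ :=
  (Matrix.trace (cfc (fun t : ℝ => t ^ (3 / 2 : ℝ)) A)).re

/-! The sharp Agmon inequality `‖u(x)‖² ≤ ‖u‖ ‖u'‖` is applied not to single eigenfunctions but to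
all combinations `∑ ξ_j φ_j` of an orthonormal family: squared, it gives `‖∑ ξ_j φ_j(x)‖⁴ ≤ |ξ|² ‖∑
ξ_j φ_j'‖²`, with global `L²` norms on the right.

Fix `x`, let `b_k` be an eigenbasis of `V(x)` with eigenvalues `β_k`, and put `a_k = ∑_j |⟨b_k,
φ_j(x)⟩|²`. The choice `ξ_j = ⟨φ_j(x), b_k⟩` yields `a_k³ ≤ ‖∑ ξ_j φ_j'‖²`. Summed over `k`, the
right side is `∑ ⟨φ_j(x), φ_i(x)⟩ ⟨φ_i', φ_j'⟩`, which integrates to `∑ ‖φ_j'‖²` by orthonormality,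
while `∑_k β_k a_k` is the potential density. Hence `∑ |λ_j|` is at most the integral of `∑_k (β_k
a_k - a_k³)`, and maximising over each `a_k ≥ 0` produces `2/(3√3) Tr V(x)^{3/2}`
(`sum_form_sub_sum_gram_le`, `sum_ofReal_abs_le_of_orthonormal`). -/

/-! ### Agmon's inequality for differentiable functions -/

/-- **Agmon's inequality** for differentiable functions. -/
theorem enorm_sq_le_eLpNorm_mul_eLpNorm_of_hasDerivAt {F : Type*} [NormedAddCommGroup F]
    [InnerProductSpace ℝ F] {v v' : ℝ → F} (hd : ∀ x, HasDerivAt v (v' x) x)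
    (hv : MemLp v 2 volume) (hv' : MemLp v' 2 volume) (x : ℝ) :
    ‖v x‖ₑ ^ 2 ≤ eLpNorm v 2 volume * eLpNorm v' 2 volume := by
  have hn : Integrable (fun y => ‖v y‖ * ‖v' y‖) := hv.norm.integrable_mul hv'.norm
  have hsq : Integrable (fun y => ‖v y‖ ^ 2) := hv.integrable_norm_pow (by norm_num)
  have hds : ∀ y, HasDerivAt (fun y => ‖v y‖ ^ 2) (2 * inner ℝ (v y) (v' y)) y :=
    fun y => (hd y).norm_sq
  have hi : Integrable (fun y => 2 * inner ℝ (v y) (v' y)) := by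
    refine (hn.const_mul 2).mono
      ((hv.1.inner hv'.1).const_mul 2) (Filter.Eventually.of_forall fun y => ?_)
    rw [norm_mul, norm_mul, Real.norm_of_nonneg (by positivity : 0 ≤ ‖v y‖ * ‖v' y‖)]
    gcongr
    exact norm_inner_le_norm _ _
  -- `‖v‖²` and its derivative are both integrable, so `‖v‖²` vanishes at both ends.
  have hbot := tendsto_zero_of_hasDerivAt_of_integrableOn_Iic (a := x) (fun y _ => hds y)
    hi.integrableOn hsq.integrableOn
  have htop := tendsto_zero_of_hasDerivAt_of_integrableOn_Ioi (a := x) (fun y _ => hds y)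
    hi.integrableOn hsq.integrableOn
  have h1 := integral_Iic_of_hasDerivAt_of_tendsto' (a := x) (fun y _ => hds y)
    hi.integrableOn hbot
  have h2 := integral_Ioi_of_hasDerivAt_of_tendsto' (a := x) (fun y _ => hds y)
    hi.integrableOn htop
  have hle : ∀ y, |2 * inner ℝ (v y) (v' y)| ≤ 2 * (‖v y‖ * ‖v' y‖) := by
    intro y
    rw [abs_mul, abs_two]
    gcongr
    exact abs_real_inner_le_norm _ _
  have h3 : ‖v x‖ ^ 2 ≤ ∫ y in Set.Iic x, 2 * (‖v y‖ * ‖v' y‖) := by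
    rw [sub_zero] at h1
    rw [← h1]
    exact integral_mono hi.integrableOn (hn.const_mul 2).integrableOn
      fun y => (le_abs_self _).trans (hle y)
  have h4 : ‖v x‖ ^ 2 ≤ ∫ y in Set.Ioi x, 2 * (‖v y‖ * ‖v' y‖) := by
    have : ‖v x‖ ^ 2 = ∫ y in Set.Ioi x, -(2 * inner ℝ (v y) (v' y)) := by
      rw [integral_neg, h2]; ring
    rw [this]
    exact integral_mono hi.neg.integrableOn (hn.const_mul 2).integrableOn
      fun y => (neg_le_abs _).trans (hle y)
  -- Adding the two half-line bounds cancels the factor 2; this gives the sharp constant 1.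
  have h5 : ‖v x‖ ^ 2 ≤ ∫ y, ‖v y‖ * ‖v' y‖ := by
    have := intervalIntegral.integral_Iic_add_Ioi (b := x) (hn.const_mul 2).integrableOn
      (hn.const_mul 2).integrableOn
    have h := integral_const_mul (μ := volume) 2 fun y => ‖v y‖ * ‖v' y‖
    linarith
  have h6 : ENNReal.ofReal (∫ y, ‖v y‖ * ‖v' y‖) = eLpNorm ((fun y => ‖v y‖) • fun y => ‖v' y‖) 1 volume := by
    rw [eLpNorm_one_eq_lintegral_enorm, ofReal_integral_eq_lintegral_ofReal hn
      (Filter.Eventually.of_forall fun y => by positivity)]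
    refine lintegral_congr fun y => ?_
    rw [Pi.smul_apply', smul_eq_mul, Real.enorm_of_nonneg (by positivity)]
  have h7 : eLpNorm ((fun y => ‖v y‖) • fun y => ‖v' y‖) 1 volume
      ≤ eLpNorm (fun y => ‖v y‖) 2 volume * eLpNorm (fun y => ‖v' y‖) 2 volume :=
    eLpNorm_smul_le_mul_eLpNorm hv'.1.norm hv.1.norm
  calc ‖v x‖ₑ ^ 2 = ENNReal.ofReal (‖v x‖ ^ 2) := by
        rw [ENNReal.ofReal_pow (norm_nonneg _), ofReal_norm]
    _ ≤ _ := ENNReal.ofReal_le_ofReal h5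
    _ ≤ eLpNorm (fun y => ‖v y‖) 2 volume * eLpNorm (fun y => ‖v' y‖) 2 volume := by
        rw [h6]
        exact h7
    _ = _ := by rw [eLpNorm_norm, eLpNorm_norm]

/-! ### Mollification and Agmon's inequality in `H¹` -/

/-- Averaging over translates does not increase the `L²` norm. -/
theorem lintegral_sq_lintegral_enorm_sub_le {F : Type*} [NormedAddCommGroup F] {f : ℝ → F}
    (hf : AEStronglyMeasurable f volume) (μ : Measure ℝ) [IsProbabilityMeasure μ]
    (hμ : μ ≪ volume) :
    ∫⁻ x, (∫⁻ t, ‖f (x - t)‖ₑ ∂μ) ^ 2 ≤ ∫⁻ x, ‖f x‖ₑ ^ 2 := by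
  have hm : AEMeasurable (fun p : ℝ × ℝ => ‖f (p.1 - p.2)‖ₑ ^ 2) (volume.prod μ) := by
    refine ((hf.comp_quasiMeasurePreserving
      (quasiMeasurePreserving_sub_of_right_invariant volume volume)).mono_ac
        (Measure.AbsolutelyContinuous.rfl.prod hμ)).enorm.pow_const 2
  have hmx : ∀ x, AEMeasurable (fun t => ‖f (x - t)‖ₑ) μ := fun x =>
    ((hf.comp_quasiMeasurePreserving
      (quasiMeasurePreserving_sub_left volume x)).mono_ac hμ).enorm
  have hcs : ∀ x, (∫⁻ t, ‖f (x - t)‖ₑ ∂μ) ^ 2 ≤ ∫⁻ t, ‖f (x - t)‖ₑ ^ 2 ∂μ := by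
    intro x
    have h := ENNReal.lintegral_mul_le_Lp_mul_Lq μ Real.HolderConjugate.two_two
      (aemeasurable_const (b := (1 : ℝ≥0∞))) (hmx x)
    simp only [Pi.mul_apply, one_mul, ENNReal.one_rpow, lintegral_const, measure_univ] at h
    calc _ ≤ ((∫⁻ t, ‖f (x - t)‖ₑ ^ (2 : ℝ) ∂μ) ^ (1 / 2 : ℝ)) ^ 2 := by gcongr
      _ = _ := by
        rw [← ENNReal.rpow_natCast, ← ENNReal.rpow_mul]
        norm_num
  calc _ ≤ ∫⁻ x, ∫⁻ t, ‖f (x - t)‖ₑ ^ 2 ∂μ := lintegral_mono hcs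
    _ = ∫⁻ t, (∫⁻ x, ‖f (x - t)‖ₑ ^ 2) ∂μ := lintegral_lintegral_swap hm
    _ = ∫⁻ _, (∫⁻ x, ‖f x‖ₑ ^ 2) ∂μ := by
        refine lintegral_congr fun t => ?_
        exact lintegral_sub_right_eq_self (fun x => ‖f x‖ₑ ^ 2) t
    _ = _ := by simp

open scoped Convolution in
/-- Convolution with a probability density does not increase the `L²` norm. -/
theorem eLpNorm_two_convolution_le {F : Type*} [NormedAddCommGroup F] [NormedSpace ℝ F]
    {f : ℝ → F} (hf : AEStronglyMeasurable f volume) {η : ℝ → ℝ} (hη : Continuous η)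
    (h0 : ∀ x, 0 ≤ η x) (h1 : ∫ x, η x = 1) (hi : Integrable η) :
    eLpNorm (η ⋆[ContinuousLinearMap.lsmul ℝ ℝ, volume] f) 2 volume ≤ eLpNorm f 2 volume := by
  have hm : Measurable fun t => ENNReal.ofReal (η t) := hη.measurable.ennreal_ofReal
  set μ : Measure ℝ := volume.withDensity fun t => ENNReal.ofReal (η t) with hμ
  have : IsProbabilityMeasure μ := by
    refine ⟨?_⟩
    rw [hμ, withDensity_apply _ MeasurableSet.univ, Measure.restrict_univ,
      ← ofReal_integral_eq_lintegral_ofReal hi (Filter.Eventually.of_forall h0), h1,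
      ENNReal.ofReal_one]
  have hac : μ ≪ volume := withDensity_absolutelyContinuous _ _
  have hpt : ∀ x, ‖(η ⋆[ContinuousLinearMap.lsmul ℝ ℝ, volume] f) x‖ₑ
      ≤ ∫⁻ t, ‖f (x - t)‖ₑ ∂μ := by
    intro x
    have hmx : AEMeasurable (fun t => ‖f (x - t)‖ₑ) volume :=
      (hf.comp_quasiMeasurePreserving (quasiMeasurePreserving_sub_left volume x)).enorm
    rw [hμ, lintegral_withDensity_eq_lintegral_mul₀ hm.aemeasurable hmx, convolution_def]
    refine (enorm_integral_le_lintegral_enorm _).trans (lintegral_mono fun t => ?_)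
    simp [enorm_smul, Real.enorm_of_nonneg (h0 t)]
  rw [eLpNorm_eq_lintegral_rpow_enorm_toReal (by norm_num) (by norm_num),
    eLpNorm_eq_lintegral_rpow_enorm_toReal (by norm_num) (by norm_num)]
  simp only [ENNReal.toReal_ofNat, ENNReal.rpow_ofNat]
  exact ENNReal.rpow_le_rpow ((lintegral_mono fun x => pow_le_pow_left' (hpt x) 2).trans
    (lintegral_sq_lintegral_enorm_sub_le hf μ hac)) (by norm_num)

-- The reflected translate `t ↦ η (x - t)` is itself a test function; its derivative has the
-- opposite sign, which absorbs the minus sign of the weak derivative.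
open scoped Convolution in
theorem deriv_convolution_eq_of_mem_weakDerivGraph {m : ℕ} {u g : L2Vec m}
    (h : (u, g) ∈ weakDerivGraph m) {η : ℝ → ℝ} (hη : ContDiff ℝ ∞ η)
    (hc : HasCompactSupport η) :
    deriv η ⋆[ContinuousLinearMap.lsmul ℝ ℝ, volume] u
      = η ⋆[ContinuousLinearMap.lsmul ℝ ℝ, volume] g := by
  ext1 x
  rw [convolution_lsmul_swap, convolution_lsmul_swap]
  have hx := h (fun t => η (x - t)) (hη.comp (contDiff_const.sub contDiff_id))
    (hc.comp_homeomorph (Homeomorph.subLeft x))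
  have hd : ∀ t, deriv (fun t => η (x - t)) t = -deriv η (x - t) := fun t => by
    rw [deriv_comp_const_sub]
  simpa only [hd, neg_smul, integral_neg, neg_inj] using hx

open scoped Convolution in
/-- **Agmon's inequality** for functions in `H¹(ℝ, ℂᵐ)`. -/
theorem ae_norm_sq_le_of_mem_weakDerivGraph {m : ℕ} {u g : L2Vec m}
    (h : (u, g) ∈ weakDerivGraph m) : ∀ᵐ x, ‖u x‖ ^ 2 ≤ ‖u‖ * ‖g‖ := by
  -- The fixed ratio 2 of outer to inner radius is what a.e. convergence of the mollifications
  -- requires.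
  let b : ℕ → ContDiffBump (0 : ℝ) := fun n =>
    ⟨1 / ((n : ℝ) + 1), 2 * (1 / ((n : ℝ) + 1)), Nat.one_div_pos_of_nat, by
      have : 0 < 1 / ((n : ℝ) + 1) := Nat.one_div_pos_of_nat
      linarith⟩
  have hb : Filter.Tendsto (fun n => (b n).rOut) Filter.atTop (nhds 0) := by
    have := (tendsto_one_div_add_atTop_nhds_zero_nat (𝕜 := ℝ)).const_mul 2
    rwa [mul_zero] at this
  have hloc : LocallyIntegrable u volume := (Lp.memLp u).locallyIntegrable (by norm_num)
  filter_upwards [ContDiffBump.ae_convolution_tendsto_right_of_locallyIntegrable (φ := b)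
    (K := 2) hb (Filter.Eventually.of_forall fun n => le_rfl) hloc] with x hx
  have hbound : ∀ n, ‖((b n).normed volume ⋆[ContinuousLinearMap.lsmul ℝ ℝ, volume] u) x‖ ^ 2
      ≤ ‖u‖ * ‖g‖ := by
    intro n
    set η := (b n).normed volume with hηdef
    have hη : ContDiff ℝ ∞ η := (b n).contDiff_normed
    have hc : HasCompactSupport η := (b n).hasCompactSupport_normed
    have hle : ∀ w : L2Vec m, eLpNorm (η ⋆[ContinuousLinearMap.lsmul ℝ ℝ, volume] w) 2 volume
        ≤ eLpNorm w 2 volume := fun w =>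
      eLpNorm_two_convolution_le (Lp.aestronglyMeasurable w) hη.continuous (b n).nonneg_normed
        (b n).integral_normed (hη.continuous.integrable_of_hasCompactSupport hc)
    have hmem : ∀ w : L2Vec m, MemLp (η ⋆[ContinuousLinearMap.lsmul ℝ ℝ, volume] w) 2 volume :=
      fun w => ⟨(hc.continuous_convolution_left _ hη.continuous
        ((Lp.memLp w).locallyIntegrable (by norm_num))).aestronglyMeasurable,
        (hle w).trans_lt (Lp.eLpNorm_lt_top w)⟩
    have hd : ∀ y, HasDerivAt (η ⋆[ContinuousLinearMap.lsmul ℝ ℝ, volume] u)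
        ((η ⋆[ContinuousLinearMap.lsmul ℝ ℝ, volume] g) y) y := fun y => by
      rw [← deriv_convolution_eq_of_mem_weakDerivGraph h hη hc]
      exact hc.hasDerivAt_convolution_left _ (hη.of_le (by simp)) hloc y
    have key := (enorm_sq_le_eLpNorm_mul_eLpNorm_of_hasDerivAt hd (hmem u) (hmem g) x).trans
      (mul_le_mul' (hle u) (hle g))
    have := ENNReal.toReal_mono
      (ENNReal.mul_ne_top (Lp.eLpNorm_ne_top u) (Lp.eLpNorm_ne_top g)) key
    rwa [ENNReal.toReal_pow, toReal_enorm, ENNReal.toReal_mul, ← Lp.norm_def, ← Lp.norm_def]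
      at this
  exact le_of_tendsto' ((hx.norm).pow 2) hbound

/-- The null set must not depend on `ξ`, since `ξ` will later be chosen depending on `x`. A
countable dense set of `ξ` gives one null set, and both sides are continuous in `ξ`. -/
theorem ae_norm_sum_smul_sq_le_of_mem_weakDerivGraph {m : ℕ} {ι : Type*} [Fintype ι]
    {φ dφ : ι → L2Vec m} (h : ∀ j, (φ j, dφ j) ∈ weakDerivGraph m) :
    ∀ᵐ x, ∀ ξ : ι → ℂ, ‖∑ j, ξ j • φ j x‖ ^ 2 ≤ ‖∑ j, ξ j • φ j‖ * ‖∑ j, ξ j • dφ j‖ := by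
  have hmem : ∀ ξ : ι → ℂ, (∑ j, ξ j • φ j, ∑ j, ξ j • dφ j) ∈ weakDerivGraph m := fun ξ => by
    have := (weakDerivGraph m).sum_mem (t := Finset.univ)
      fun j _ => (weakDerivGraph m).smul_mem (ξ j) (h j)
    convert this using 1
    ext1 <;> simp [Prod.fst_sum, Prod.snd_sum]
  have hcoe : ∀ ξ : ι → ℂ, ∀ᵐ x, (∑ j, ξ j • φ j : L2Vec m) x = ∑ j, ξ j • φ j x := fun ξ => by
    have h1 : ∀ᵐ x, ∀ j, (ξ j • φ j) x = ξ j • φ j x :=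
      ae_all_iff.2 fun j => Lp.coeFn_smul (ξ j) (φ j)
    filter_upwards [Lp.coeFn_finsetSum Finset.univ fun j => ξ j • φ j, h1] with x hx hx1
    rw [hx, Finset.sum_apply]
    exact Finset.sum_congr rfl fun j _ => hx1 j
  obtain ⟨s, hs, hsd⟩ := TopologicalSpace.exists_countable_dense (ι → ℂ)
  have hae : ∀ᵐ x, ∀ ξ ∈ s,
      ‖∑ j, ξ j • φ j x‖ ^ 2 ≤ ‖∑ j, ξ j • φ j‖ * ‖∑ j, ξ j • dφ j‖ := by
    refine (ae_ball_iff hs).2 fun ξ _ => ?_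
    filter_upwards [ae_norm_sq_le_of_mem_weakDerivGraph (hmem ξ), hcoe ξ] with x hx hx1
    rwa [← hx1]
  filter_upwards [hae] with x hx ξ
  have hclosed : IsClosed {ξ : ι → ℂ |
      ‖∑ j, ξ j • φ j x‖ ^ 2 ≤ ‖∑ j, ξ j • φ j‖ * ‖∑ j, ξ j • dφ j‖} :=
    isClosed_le (by fun_prop) (by fun_prop)
  exact hclosed.closure_subset_iff.2 hx (hsd ξ)

/-! ### Pointwise matrix estimate -/

/-- The Young-type inequality dual to `t ↦ t³`, with sharp constant. -/
theorem mul_sub_cube_le {a β : ℝ} (ha : 0 ≤ a) (hβ : 0 ≤ β) :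
    β * a - a ^ 3 ≤ 2 / (3 * √3) * β ^ (3 / 2 : ℝ) := by
  -- The maximiser of `a ↦ β a - a³` on `a ≥ 0`; the claim becomes `(a - s)² (a + 2 s) ≥ 0`.
  set s := √(β / 3) with hs
  have hs0 : 0 ≤ s := Real.sqrt_nonneg _
  have hβs : β = 3 * s ^ 2 := by
    rw [hs, Real.sq_sqrt (by positivity)]; ring
  have hpow : β ^ (3 / 2 : ℝ) = 3 * √3 * s ^ 3 := by
    have h1 : √β = √3 * s := by
      rw [hs, ← Real.sqrt_mul (by norm_num)]
      congr 1; ring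
    rw [show (3 / 2 : ℝ) = (1 / 2 : ℝ) * (3 : ℕ) by norm_num, Real.rpow_mul_natCast hβ,
      ← Real.sqrt_eq_rpow, h1, mul_pow, pow_succ √3 2, Real.sq_sqrt (by norm_num)]
  have h3 : (0 : ℝ) < 3 * √3 := by positivity
  rw [hpow, ← mul_assoc, div_mul_cancel₀ _ h3.ne', hβs]
  nlinarith [mul_nonneg (sq_nonneg (a - s)) (by positivity : 0 ≤ a + 2 * s)]

theorem traceThreeHalves_eq_sum {m : ℕ} {A : Matrix (Fin m) (Fin m) ℂ} (hA : A.IsHermitian) :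
    traceThreeHalves A = ∑ i, hA.eigenvalues i ^ (3 / 2 : ℝ) := by
  rw [traceThreeHalves, hA.cfc_eq, Matrix.IsHermitian.cfc, Unitary.conjStarAlgAut_apply,
    Matrix.trace_mul_cycle, Unitary.coe_star_mul_self, one_mul, Matrix.trace_diagonal,
    Complex.re_sum]
  rfl

/-- The quadratic form of a Hermitian matrix in its eigenbasis. -/
theorem Matrix.IsHermitian.star_dotProduct_mulVec_eq_sum {m : ℕ} {A : Matrix (Fin m) (Fin m) ℂ}
    (hA : A.IsHermitian) (v : EuclideanSpace ℂ (Fin m)) :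
    star v.ofLp ⬝ᵥ (A *ᵥ v.ofLp)
      = ((∑ i, hA.eigenvalues i * ‖inner ℂ (hA.eigenvectorBasis i) v‖ ^ 2 : ℝ) : ℂ) := by
  have hsum : A *ᵥ v.ofLp = (∑ i, (hA.eigenvalues i * inner ℂ (hA.eigenvectorBasis i) v) •
      hA.eigenvectorBasis i).ofLp := by
    conv_lhs => rw [← hA.eigenvectorBasis.sum_repr' v]
    simp only [WithLp.ofLp_sum, WithLp.ofLp_smul, Matrix.mulVec_sum, Matrix.mulVec_smul,
      hA.mulVec_eigenvectorBasis]
    refine Finset.sum_congr rfl fun i _ => ?_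
    rw [← Complex.coe_smul, smul_smul, mul_comm]
  have hin : star v.ofLp ⬝ᵥ (A *ᵥ v.ofLp) = inner ℂ v (WithLp.toLp 2 (A *ᵥ v.ofLp)) := by
    rw [EuclideanSpace.inner_eq_star_dotProduct, dotProduct_comm]
  rw [hin, hsum, WithLp.toLp_ofLp, inner_sum]
  push_cast
  refine Finset.sum_congr rfl fun i _ => ?_
  rw [inner_smul_right, mul_assoc, ← inner_conj_symm v, mul_comm (inner ℂ _ v),
    ← Complex.normSq_eq_conj_mul_self, Complex.normSq_eq_norm_sq]
  norm_cast

theorem Matrix.IsHermitian.star_star_dotProduct_mulVec {m : ℕ} {A : Matrix (Fin m) (Fin m) ℂ}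
    (hA : A.IsHermitian) (v w : Fin m → ℂ) :
    star (star v ⬝ᵥ (A *ᵥ w)) = star w ⬝ᵥ (A *ᵥ v) := by
  rw [← Matrix.star_dotProduct, Matrix.star_mulVec, hA.eq, ← Matrix.dotProduct_mulVec]

/-- A pointwise bound: if `‖∑ ξⱼ vⱼ‖⁴ ≤ |ξ|² ⟨ξ, K ξ⟩` for all `ξ`, where `K` is the Gram matrix
of `w`, then `∑ ⟨vⱼ, A vⱼ⟩ - ∑ ⟨vⱼ, vᵢ⟩ Kᵢⱼ` is bounded in terms of `Tr A^{3/2}`. -/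
theorem sum_form_sub_sum_gram_le {m : ℕ} {ι E : Type*} [Fintype ι] [NormedAddCommGroup E]
    [InnerProductSpace ℂ E] {A : Matrix (Fin m) (Fin m) ℂ} (hA : A.PosSemidef)
    (v : ι → EuclideanSpace ℂ (Fin m)) (w : ι → E)
    (h : ∀ ξ : ι → ℂ, (‖∑ j, ξ j • v j‖ ^ 2) ^ 2 ≤ (∑ j, ‖ξ j‖ ^ 2) * ‖∑ j, ξ j • w j‖ ^ 2) :
    (∑ j, star (v j).ofLp ⬝ᵥ (A *ᵥ (v j).ofLp)).re
        - (∑ i, ∑ j, inner ℂ (v j) (v i) * inner ℂ (w i) (w j)).re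
      ≤ 2 / (3 * √3) * traceThreeHalves A := by
  set b := hA.1.eigenvectorBasis with hb
  set a : Fin m → ℝ := fun k => ∑ j, ‖inner ℂ (b k) (v j)‖ ^ 2 with ha
  have ha0 : ∀ k, 0 ≤ a k := fun k => Finset.sum_nonneg fun j _ => sq_nonneg _
  have hform : (∑ j, star (v j).ofLp ⬝ᵥ (A *ᵥ (v j).ofLp)).re
      = ∑ k, hA.1.eigenvalues k * a k := by
    simp only [hA.1.star_dotProduct_mulVec_eq_sum, ← Complex.ofReal_sum, Complex.ofReal_re]
    rw [Finset.sum_comm]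
    simp only [ha, Finset.mul_sum, hb]
  have hgram : (∑ i, ∑ j, inner ℂ (v j) (v i) * inner ℂ (w i) (w j)).re
      = ∑ k, ‖∑ j, (inner ℂ (v j) (b k) : ℂ) • w j‖ ^ 2 := by
    have : ∑ i, ∑ j, inner ℂ (v j) (v i) * inner ℂ (w i) (w j)
        = ((∑ k, ‖∑ j, (inner ℂ (v j) (b k) : ℂ) • w j‖ ^ 2 : ℝ) : ℂ) := by
      have hk : ∀ k, ((‖∑ j, (inner ℂ (v j) (b k) : ℂ) • w j‖ ^ 2 : ℝ) : ℂ)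
          = ∑ i, ∑ j, inner ℂ (v j) (b k) * inner ℂ (b k) (v i) * inner ℂ (w i) (w j) := by
        intro k
        rw [Complex.ofReal_pow]
        refine (inner_self_eq_norm_sq_to_K (𝕜 := ℂ)
          (∑ j, (inner ℂ (v j) (b k) : ℂ) • w j)).symm.trans ?_
        simp only [sum_inner, inner_sum, inner_smul_left, inner_smul_right, inner_conj_symm]
        simp only [Finset.mul_sum, mul_assoc]
        exact Finset.sum_comm
      rw [Complex.ofReal_sum, Finset.sum_congr rfl fun k _ => hk k]
      refine Eq.trans ?_ Finset.sum_comm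
      refine Finset.sum_congr rfl fun i _ => ?_
      refine Eq.trans ?_ Finset.sum_comm
      refine Finset.sum_congr rfl fun j _ => ?_
      -- Parseval in the eigenbasis removes it from the sum.
      rw [← Finset.sum_mul, b.sum_inner_mul_inner]
    rw [this, Complex.ofReal_re]
  have hcube : ∀ k, a k ^ 3 ≤ ‖∑ j, (inner ℂ (v j) (b k) : ℂ) • w j‖ ^ 2 := by
    intro k
    -- With this `ξ`, both `|ξ|²` and the `b k`-component of `∑ ξ_j v_j` equal `a k`.
    have h1 := h fun j => inner ℂ (v j) (b k)
    have h2 : ∑ j, ‖(inner ℂ (v j) (b k) : ℂ)‖ ^ 2 = a k := by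
      simp only [ha]
      exact Finset.sum_congr rfl fun j _ => by rw [norm_inner_symm]
    have h3 : inner ℂ (b k) (∑ j, (inner ℂ (v j) (b k) : ℂ) • v j) = (a k : ℂ) := by
      simp only [ha, inner_sum, inner_smul_right]
      push_cast
      refine Finset.sum_congr rfl fun j _ => ?_
      rw [← inner_conj_symm (v j), ← Complex.normSq_eq_conj_mul_self, Complex.normSq_eq_norm_sq]
      norm_cast
    have h4 : a k ≤ ‖∑ j, (inner ℂ (v j) (b k) : ℂ) • v j‖ := by
      have := norm_inner_le_norm (𝕜 := ℂ) (b k) (∑ j, (inner ℂ (v j) (b k) : ℂ) • v j)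
      rwa [h3, b.norm_eq_one, one_mul, Complex.norm_real, Real.norm_of_nonneg (ha0 k)] at this
    rw [h2] at h1
    rcases (ha0 k).eq_or_lt with h0 | h0
    · rw [← h0]; simp
    · have h5 : (a k ^ 2) ^ 2 ≤ a k * ‖∑ j, (inner ℂ (v j) (b k) : ℂ) • w j‖ ^ 2 :=
        le_trans (by gcongr) h1
      refine le_of_mul_le_mul_left ?_ h0
      linarith [show a k * a k ^ 3 = (a k ^ 2) ^ 2 by ring]
  rw [hform, hgram, traceThreeHalves_eq_sum hA.1, Finset.mul_sum, ← Finset.sum_sub_distrib]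
  refine Finset.sum_le_sum fun k _ => ?_
  linarith [hcube k, mul_sub_cube_le (ha0 k) (hA.eigenvalues_nonneg k)]

/-! ### Finite orthonormal families of eigenfunctions -/

theorem ofReal_integral_le_lintegral_ofReal {α : Type*} {mα : MeasurableSpace α} {μ : Measure α}
    {f : α → ℝ} (hf : Integrable f μ) :
    ENNReal.ofReal (∫ x, f x ∂μ) ≤ ∫⁻ x, ENNReal.ofReal (f x) ∂μ := by
  rw [integral_eq_lintegral_pos_part_sub_lintegral_neg_part hf]
  refine (ENNReal.ofReal_le_ofReal (sub_le_self _ ENNReal.toReal_nonneg)).trans ?_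
  exact ENNReal.ofReal_toReal_le

/-- Eigenfunctions of `H` for different real eigenvalues are orthogonal. -/
theorem inner_eq_zero_of_mem_schrodingerGraph {m : ℕ} {V : ℝ → Matrix (Fin m) (Fin m) ℂ}
    (hV : ∀ᵐ x, (V x).IsHermitian) {φ ψ : L2Vec m} {lam mu : ℝ}
    (hφ : (φ, (lam : ℂ) • φ) ∈ schrodingerGraph V) (hψ : (ψ, (mu : ℂ) • ψ) ∈ schrodingerGraph V)
    (hne : lam ≠ mu) : inner ℂ φ ψ = 0 := by
  obtain ⟨dφ, hdφ, h1⟩ := hφ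
  obtain ⟨dψ, hdψ, h2⟩ := hψ
  have e1 := (h1 ψ dψ hdψ).2
  have e2 := (h2 φ dφ hdφ).2
  have hc : ∫ x, potentialDensity V φ ψ x = starRingEnd ℂ (∫ x, potentialDensity V ψ φ x) := by
    rw [← integral_conj]
    refine integral_congr_ae ?_
    filter_upwards [hV] with x hx
    exact (hx.star_star_dotProduct_mulVec _ _).symm
  have e3 := congrArg (starRingEnd ℂ) e1
  simp only [map_sub, inner_conj_symm, ← hc, e2, inner_smul_right, map_mul,
    Complex.conj_ofReal] at e3
  have h0 : ((mu : ℂ) - lam) * inner ℂ φ ψ = 0 := by rw [sub_mul, e3, sub_self]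
  refine (mul_eq_zero.mp h0).resolve_left (sub_ne_zero.mpr ?_)
  exact_mod_cast hne.symm

/-- The Lieb–Thirring bound for finitely many orthonormal eigenfunctions. -/
theorem sum_ofReal_abs_le_of_orthonormal {m : ℕ} {V : ℝ → Matrix (Fin m) (Fin m) ℂ}
    (hpos : ∀ᵐ x, (V x).PosSemidef) {ι : Type*} [Fintype ι] [DecidableEq ι] {φ : ι → L2Vec m}
    (hφ : Orthonormal ℂ φ) {lam : ι → ℝ} (hlam : ∀ j, lam j < 0)
    (hmem : ∀ j, (φ j, (lam j : ℂ) • φ j) ∈ schrodingerGraph V) :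
    ∑ j, ENNReal.ofReal |lam j| ≤
      ENNReal.ofReal (2 / (3 * √3)) * ∫⁻ x, ENNReal.ofReal (traceThreeHalves (V x)) := by
  choose dφ hd hform using hmem
  simp only at hd hform
  have hnorm : ∀ ξ : ι → ℂ, ‖∑ j, ξ j • φ j‖ ^ 2 = ∑ j, ‖ξ j‖ ^ 2 := fun ξ => by
    have := hφ.inner_sum ξ ξ Finset.univ
    rw [inner_self_eq_norm_sq_to_K] at this
    have h2 : ∑ j, (starRingEnd ℂ) (ξ j) * ξ j = ((∑ j, ‖ξ j‖ ^ 2 : ℝ) : ℂ) := by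
      push_cast
      refine Finset.sum_congr rfl fun j _ => ?_
      rw [← Complex.normSq_eq_conj_mul_self, Complex.normSq_eq_norm_sq]
      norm_cast
    rw [h2] at this
    refine Complex.ofReal_injective ?_
    rw [Complex.ofReal_pow]
    exact this
  set P : ℝ → ℂ := fun x => ∑ j, potentialDensity V (φ j) (φ j) x with hP
  set K : ℝ → ℂ := fun x => ∑ i, ∑ j, inner ℂ (φ j x) (φ i x) * inner ℂ (dφ i) (dφ j) with hK
  have hPint : Integrable P :=
    integrable_finsetSum _ fun j _ => (hform j (φ j) (dφ j) (hd j)).1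
  have hKint : Integrable K :=
    integrable_finsetSum _ fun i _ => integrable_finsetSum _ fun j _ =>
      (L2.integrable_inner (𝕜 := ℂ) (φ j) (φ i)).mul_const _
  have hKval : ∫ x, K x = ∑ i, inner ℂ (dφ i) (dφ i) := by
    rw [hK, integral_finsetSum _ fun i _ => integrable_finsetSum _ fun j _ =>
      (L2.integrable_inner (𝕜 := ℂ) (φ j) (φ i)).mul_const _]
    refine Finset.sum_congr rfl fun i _ => ?_
    rw [integral_finsetSum _ fun j _ => (L2.integrable_inner (𝕜 := ℂ) (φ j) (φ i)).mul_const _]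
    -- Orthonormality leaves only the diagonal, so `K` integrates to the kinetic energy.
    have : ∀ j, ∫ x, inner ℂ (φ j x) (φ i x) * inner ℂ (dφ i) (dφ j)
        = if j = i then inner ℂ (dφ i) (dφ j) else 0 := fun j => by
      rw [integral_mul_const, ← L2.inner_def, orthonormal_iff_ite.1 hφ j i]
      split_ifs <;> simp
    simp [this]
  have hPval : ∫ x, P x = ∑ i, (inner ℂ (dφ i) (dφ i) - (lam i : ℂ)) := by
    rw [hP, integral_finsetSum _ fun j _ => (hform j (φ j) (dφ j) (hd j)).1]
    refine Finset.sum_congr rfl fun j _ => ?_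
    have := (hform j (φ j) (dφ j) (hd j)).2
    rw [inner_smul_right, inner_self_eq_norm_sq_to_K (φ j), hφ.1 j] at this
    simp only [RCLike.ofReal_one, one_pow, mul_one] at this
    rw [← this]; ring
  have hsum : ∑ j, |lam j| = ∫ x, ((P x).re - (K x).re) := by
    have h0 : ∫ x, ((P x).re - (K x).re) = (∫ x, (P x).re) - ∫ x, (K x).re :=
      integral_sub hPint.re hKint.re
    have h1 : ∫ x, (P x).re = (∫ x, P x).re := integral_re hPint
    have h2 : ∫ x, (K x).re = (∫ x, K x).re := integral_re hKint
    rw [h0, h1, h2, ← Complex.sub_re, hPval, hKval, ← Finset.sum_sub_distrib, Complex.re_sum]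
    refine Finset.sum_congr rfl fun j _ => ?_
    simp [abs_of_neg (hlam j)]
  have hpt : ∀ᵐ x, (P x).re - (K x).re ≤ 2 / (3 * √3) * traceThreeHalves (V x) := by
    filter_upwards [hpos, ae_norm_sum_smul_sq_le_of_mem_weakDerivGraph hd] with x hx hxi
    refine sum_form_sub_sum_gram_le hx (fun j => φ j x) dφ fun ξ => ?_
    rw [← hnorm, ← mul_pow]
    exact pow_le_pow_left₀ (sq_nonneg _) (hxi ξ) 2
  rw [← ENNReal.ofReal_sum_of_nonneg fun j _ => abs_nonneg _, hsum]
  -- Passing to the lower integral here lets the right side be infinite.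
  refine (ofReal_integral_le_lintegral_ofReal (hPint.re.sub hKint.re)).trans ?_
  rw [← lintegral_const_mul' _ _ ENNReal.ofReal_ne_top]
  refine lintegral_mono_ae ?_
  filter_upwards [hpt] with x hx
  rw [← ENNReal.ofReal_mul (by positivity)]
  exact ENNReal.ofReal_le_ofReal hx

/-! ### Multiplicities and the full sum -/

theorem Submodule.exists_orthonormal_of_le_rank {E : Type*} [NormedAddCommGroup E]
    [InnerProductSpace ℂ E] {W : Submodule ℂ E} {n : ℕ} (h : (n : Cardinal) ≤ Module.rank ℂ W) :
    ∃ e : Fin n → E, Orthonormal ℂ e ∧ ∀ i, e i ∈ W := by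
  obtain ⟨v, hv⟩ := Module.le_rank_iff.1 h
  exact ⟨fun i => (InnerProductSpace.gramSchmidtNormed ℂ v i : W),
    (InnerProductSpace.gramSchmidtNormed_orthonormal hv).comp_linearIsometry W.subtypeₗᵢ,
    fun i => Subtype.coe_prop _⟩

/-- Orthonormal families in the separate eigenspaces join into one, as distinct eigenvalues have
orthogonal eigenfunctions. Allowing any `n` below the multiplicity also covers infinite
multiplicities. -/
theorem sum_natCast_mul_le_of_le_multiplicity {m : ℕ} {V : ℝ → Matrix (Fin m) (Fin m) ℂ}
    (hpos : ∀ᵐ x, (V x).PosSemidef) (s : Finset {lam : ℝ // lam < 0})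
    {n : {lam : ℝ // lam < 0} → ℕ}
    (hn : ∀ lam ∈ s, (n lam : ℕ∞) ≤ (schrodinger V).multiplicity ((lam : ℝ) : ℂ)) :
    ∑ lam ∈ s, (n lam : ℝ≥0∞) * ENNReal.ofReal |(lam : ℝ)| ≤
      ENNReal.ofReal (2 / (3 * √3)) * ∫⁻ x, ENNReal.ofReal (traceThreeHalves (V x)) := by
  have hex : ∀ lam : s, ∃ e : Fin (n lam) → L2Vec m, Orthonormal ℂ e ∧
      ∀ i, e i ∈ (schrodinger V).eigenspace ((lam : ℝ) : ℂ) := fun lam =>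
    Submodule.exists_orthonormal_of_le_rank (Cardinal.natCast_le_toENat.1 (hn lam lam.2))
  choose e he hmem using hex
  have hgraph : ∀ p : Σ lam : s, Fin (n lam),
      (e p.1 p.2, ((p.1 : ℝ) : ℂ) • e p.1 p.2) ∈ schrodingerGraph V := fun p => by
    have := hmem p.1 p.2
    rwa [LinearPMap.eigenspace, schrodinger_graph] at this
  have horth : Orthonormal ℂ fun p : Σ lam : s, Fin (n lam) => e p.1 p.2 := by
    refine ⟨fun p => (he p.1).1 p.2, ?_⟩
    rintro ⟨l, i⟩ ⟨l', i'⟩ hne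
    by_cases hl : l = l'
    · subst hl
      exact (he l).2 fun h => hne (congrArg (Sigma.mk l) h)
    · exact inner_eq_zero_of_mem_schrodingerGraph (hpos.mono fun x hx => hx.1)
        (hgraph ⟨l, i⟩) (hgraph ⟨l', i'⟩) fun h => hl (Subtype.ext (Subtype.ext h))
  have := sum_ofReal_abs_le_of_orthonormal hpos horth (lam := fun p => ((p.1 : _) : ℝ))
    (fun p => p.1.1.2) hgraph
  rw [Fintype.sum_sigma] at this
  simpa [Finset.sum_attach s fun lam => (n lam : ℝ≥0∞) * ENNReal.ofReal |(lam : ℝ)|,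
    ← Finset.attach_eq_univ] using this

theorem theorem1 (m : ℕ) (V : ℝ → Matrix (Fin m) (Fin m) ℂ)
    (hmeas : ∀ i j, AEMeasurable (fun x => V x i j) volume)
    (hpos : ∀ᵐ x, (V x).PosSemidef) :
    (schrodinger V).sumAbsNegEigenvalues ≤
      ENNReal.ofReal (2 / (3 * √3)) * ∫⁻ x, ENNReal.ofReal (traceThreeHalves (V x)) := by
  set R := ENNReal.ofReal (2 / (3 * √3)) * ∫⁻ x, ENNReal.ofReal (traceThreeHalves (V x)) with hR
  by_cases htop : R = ⊤
  · rw [htop]; exact le_top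
  -- An infinite multiplicity would give `N |λ| ≤ R` for every `N`, impossible for finite `R`.
  have hfin : ∀ lam : {lam : ℝ // lam < 0},
      (schrodinger V).multiplicity ((lam : ℝ) : ℂ) ≠ ⊤ := by
    intro lam hinf
    have hb : ∀ N : ℕ, (N : ℝ≥0∞) * ENNReal.ofReal |(lam : ℝ)| ≤ R := fun N => by
      simpa using sum_natCast_mul_le_of_le_multiplicity hpos {lam} (n := fun _ => N)
        (by simp [hinf])
    have hl : ENNReal.ofReal |(lam : ℝ)| ≠ 0 := by
      simpa using lam.2.ne
    obtain ⟨N, hN⟩ := ENNReal.exists_nat_mul_gt hl htop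
    exact (hb N).not_gt hN
  rw [LinearPMap.sumAbsNegEigenvalues, ENNReal.tsum_eq_iSup_sum]
  refine iSup_le fun s => ?_
  refine le_trans (le_of_eq (Finset.sum_congr rfl fun lam _ => ?_))
    (sum_natCast_mul_le_of_le_multiplicity hpos s
      (n := fun lam => ((schrodinger V).multiplicity ((lam : ℝ) : ℂ)).toNat)
      fun lam _ => (ENat.natCast_toNat (hfin lam)).le)
  congr 1
  conv_lhs => rw [← ENat.natCast_toNat (hfin lam)]
  simp
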